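/- Let $\mathrm{ACF}$ be the theory of algebraically closed fields (of arbitrary characteristic), and let $\mathrm{Emb}(\mathrm{ACF})$ be the category of algebraically closed fields and field embeddings. For subsets $A,B,C$ of an algebraically closed field $M$, write $A \perp_C B$ (non-forking, i.e. algebraic, independence) if every finite tuple from $A$ that is algebraically independent over the subfield generated by $C$ is algebraically independent over the subfield generated by $C\cup B$. For $n\in\mathbb{N}$ let $\mathcal{P}(n)$ be the poset of subsets of $\{0,\dots,n-1\}$ ordered by inclusion and $\mathcal{P}^-(n)=\mathcal{P}(n)\setminus\{\{0,\dots,n-1\}\}$, both regarded as categories. A $\mathcal{P}(n)$-system (respectively, a $\mathcal{P}^-(n)$-system) of $\mathrm{ACF}$ is a functor $F$ from $\mathcal{P}(n)$ (respectively, $\mathcal{P}^-(n)$) to $\mathrm{Emb}(\mathrm{ACF})$; write $F_a=F(a)$. The system is independent if for every $a$ in the index category and every $b\subseteq a$, $$F_b \perp_{\bigcup_{c\subsetneq b}F_c}\ \bigcup_{d\subseteq a,\ b\not\subseteq d}F_d \qquad\text{inside } F_a,$$ where each $F_e$ with $e\subseteq a$ is identified with its image in $F_a$ under the embedding $F(e\to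 a)$. Then $\mathrm{ACF}$ has $n$-amalgamation for every $n$: every independent $\mathcal{P}^-(n)$-system $F$ of $\mathrm{ACF}$ can be completed to an independent $\mathcal{P}(n)$-system of $\mathrm{ACF}$, i.e. there is an independent $\mathcal{P}(n)$-system $G$ whose restriction to $\mathcal{P}^-(n)$ is naturally isomorphic to $F$. -/

import Mathlib

open CategoryTheory

universe u v w

/-- The category `P⁻(n)` of proper subsets of `{0, …, n - 1}`, ordered by inclusion
(a unique morphism `a ⟶ b` if `a ⊆ b`). The category `P(n)` is `Finset (Fin n)`. -/
abbrev ProperSubsets (n : ℕ) : Type := {a : Finset (Fin n) // a ≠ Finset.univ}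

/-- The inclusion functor `P⁻(n) ⥤ P(n)`. -/
def ProperSubsets.incl (n : ℕ) : ProperSubsets n ⥤ Finset (Fin n) :=
  Monotone.functor (f := fun a : ProperSubsets n => (a : Finset (Fin n))) fun _ _ h => h

section Systems

variable {K : Type v} [Category.{w} K] {FK : K → K → Type*} {CK : K → Type u}
  [∀ X Y, FunLike (FK X Y) (CK X) (CK Y)] [ConcreteCategory K FK]

/-- The image of `F_b` in `F_a`, for `b ≤ a`. -/
def systemImage {P : Type} [Preorder P] (F : P ⥤ K) {b a : P} (h : b ≤ a) :
    Set (CK (F.obj a)) :=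
  Set.range (ConcreteCategory.hom (F.map (homOfLE h)))

/-- A system `F` indexed by `P` (to be used with `P(n)` and `P⁻(n)`) is independent with respect to
a ternary relation `Indep M A C B` (read: `A` is independent from `B` over `C` in `M`) if for all
`b ⊆ a`, inside `F_a`, the image of `F_b` is independent from the union of the images of the `F_d`
with `d ⊆ a`, `b ⊈ d`, over the union of the images of the `F_c` with `c ⊊ b`. -/
def IsIndependentSystem (Indep : ∀ M : K, Set (CK M) → Set (CK M) → Set (CK M) → Prop)
    {P : Type} [Preorder P] (F : P ⥤ K) : Prop :=
  ∀ (a b : P) (hba : b ≤ a),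
    Indep (F.obj a)
      (systemImage F hba)
      (⋃ (c : P) (hc : c < b), systemImage F (hc.le.trans hba))
      (⋃ (d : P) (hd : d ≤ a) (_ : ¬ b ≤ d), systemImage F hd)

/-- `K` has `n`-amalgamation with respect to `Indep`: every independent `P⁻(n)`-system in `K` can be
completed to an independent `P(n)`-system in `K`. -/
def HasAmalgamation (Indep : ∀ M : K, Set (CK M) → Set (CK M) → Set (CK M) → Prop)
    (n : ℕ) : Prop :=
  ∀ F : ProperSubsets n ⥤ K, IsIndependentSystem Indep F →
    ∃ G : Finset (Fin n) ⥤ K, IsIndependentSystem Indep G ∧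
      Nonempty (ProperSubsets.incl n ⋙ G ≅ F)

end Systems

/-- An algebraically closed field (of any characteristic), bundled: a model of ACF. -/
structure ACFModel : Type (u + 1) where
  carrier : Type u
  [field : Field carrier]
  [isAlgClosed : IsAlgClosed carrier]

namespace ACFModel

instance : CoeSort ACFModel.{u} (Type u) := ⟨ACFModel.carrier⟩

attribute [instance] ACFModel.field ACFModel.isAlgClosed

/-- The category `Emb(ACF)`: the embeddings between fields are exactly the ring homomorphisms. -/
instance : Category.{u} ACFModel.{u} where
  Hom M N := M →+* N
  id M := RingHom.id M
  comp f g := RingHom.comp g f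

instance : ConcreteCategory ACFModel.{u} (fun M N : ACFModel.{u} => M →+* N) where
  hom f := f
  ofHom f := f

/-- Non-forking independence in ACF, that is, algebraic independence: `A` is independent from `B`
over `C` in `M` if every finite tuple from `A` which is algebraically independent over (the subfield
generated by) `C` is still algebraically independent over (the subfield generated by) `C ∪ B`. -/
def Indep (M : ACFModel.{u}) (A C B : Set M) : Prop :=
  ∀ (m : ℕ) (x : Fin m → M), (∀ i, x i ∈ A) →
    AlgebraicIndependent (Subfield.closure C) x →
      AlgebraicIndependent (Subfield.closure (C ∪ B)) x

end ACFModel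

/-! In each `F_d`, choose a transcendence basis `gen d` over the field generated by the images of
the `F_e`, `e < d`. It suffices to map the whole system compatibly into one algebraically closed
field `L` so that each `gen c` is independent over the images of all `F_d` with `c ≰ d` (a
`Realization`); then `L` is the top vertex.

A realization is built one index at a time. To add a maximal `c`, adjoin a fresh independent tuple
to `L`, send `gen c` to it, and extend to `F_c` by algebraicity. This needs the maps on the `F_e`,
`e < c`, to come from one homomorphism on the field they generate in `F_c`. That field already
carries a realization, so the point is uniqueness of realizations
(`Realization.exists_ringHom_span`).

Uniqueness is again by induction on indices. The fields spanned by `J` and by `F_c` glue uniquely if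
they are linearly disjoint over the field `K` generated by the `F_(d ⊓ c)`, `d ∈ J`
(`Realization.linearIndependent_span`). To see this, specialize all generators at indices `d ≰ c`,
which are independent over `F_c`, to elements of `F_⊥`, keeping `F_c` fixed. As each `F_(d ⊓ c)` is
algebraically closed, `F_d` specializes into it, so a linear relation over the span of `J` becomes a
nontrivial one over `K`. A specialization is defined only on a subring, hence the use of families
that are homomorphisms eventually. -/

/-! ### Exchange for algebraic independence over subfields -/

section AlgebraicIndependence

variable {M L : Type*} [Field M] [Field L] {ι ι' : Type*}

theorem AlgebraicIndependent.subfield_mono {k₁ k₂ : Subfield M} (h : k₁ ≤ k₂) {x : ι → M}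
    (hx : AlgebraicIndependent k₂ x) : AlgebraicIndependent k₁ x :=
  AlgebraicIndependent.of_ringHom_of_comp_eq (Subfield.inclusion h) (RingHom.id M) (x := x) hx
    (Subfield.inclusion h).injective rfl

/-- Algebraic independence over a subfield is invariant under field embeddings. -/
theorem algebraicIndependent_subfield_map_iff (σ : M →+* L) (k : Subfield M) {x : ι → M} :
    AlgebraicIndependent (k.map σ) (σ ∘ x) ↔ AlgebraicIndependent k x := by
  let e : k →+* k.map σ := (σ.comp k.subtype).codRestrict _ fun y => ⟨y, y.2, rfl⟩
  refine ⟨fun h => h.of_ringHom_of_comp_eq e σ e.injective rfl,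
    fun h => h.ringHom_of_comp_eq e σ ?_ σ.injective rfl⟩
  rintro ⟨_, y, hy, rfl⟩
  exact ⟨⟨y, hy⟩, rfl⟩

theorem Subfield.closure_union_range_eq_adjoin (k : Subfield M) (y : ι → M) :
    Subfield.closure ((k : Set M) ∪ Set.range y) =
      (IntermediateField.adjoin k (Set.range y)).toSubfield := by
  rw [IntermediateField.adjoin_toSubfield]
  congr 2
  ext z
  exact ⟨fun h => ⟨⟨z, h⟩, rfl⟩, by rintro ⟨z, rfl⟩; exact z.2⟩

theorem isAlgebraic_subfield_mono {k₁ k₂ : Subfield M} (h : k₁ ≤ k₂) {z : M}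
    (hz : IsAlgebraic k₁ z) : IsAlgebraic k₂ z := by
  let _ := (Subfield.inclusion h).toAlgebra
  have : IsScalarTower k₁ k₂ M := .of_algebraMap_eq fun _ => rfl
  exact hz.tower_top k₂

theorem IsAlgebraic.subfield_map (σ : M →+* L) {k : Subfield M} {z : M} (hz : IsAlgebraic k z) :
    IsAlgebraic (k.map σ) (σ z) := by
  let e : k →+* k.map σ := (σ.comp k.subtype).codRestrict _ fun y => ⟨y, y.2, rfl⟩
  exact hz.ringHom_of_comp_eq e σ e.injective rfl

/-- Symmetry of algebraic independence: if `x` is independent over `k` and `y` is independent over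
a field containing `k(x)`, then `x` is independent over every field algebraic over `k(y)`. -/
theorem AlgebraicIndependent.exchange {k k₁ k₂ : Subfield M} {x : ι → M} {y : ι' → M}
    (hk : k ≤ k₁) (hxk : ∀ i, x i ∈ k₁) (hx : AlgebraicIndependent k x)
    (hy : AlgebraicIndependent k₁ y)
    (hk₂ : ∀ z ∈ k₂, IsAlgebraic (Subfield.closure ((k : Set M) ∪ Set.range y)) z) :
    AlgebraicIndependent k₂ x := by
  let _ := (Subfield.inclusion hk).toAlgebra
  have : IsScalarTower k k₁ M := .of_algebraMap_eq fun _ => rfl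
  -- Independence of the joint tuple does not depend on its order; this is the source of the
  -- symmetry.
  have hsum : AlgebraicIndependent k (Sum.elim y x) := by
    refine hx.sumElim_of_tower (S := k₁) ?_ hy
    rintro _ ⟨i, rfl⟩
    exact ⟨⟨x i, hxk i⟩, rfl⟩
  have hsum' : AlgebraicIndependent k (Sum.elim x y) :=
    (algebraicIndependent_equiv' (Equiv.sumComm ι ι') (by ext (_ | _) <;> rfl)).2 hsum
  have h1 := (AlgebraicIndependent.sumElim_iff.1 hsum').2
  have h2 := (IntermediateField.algebraicIndependent_adjoin_iff).2 h1
  have h3 := h2.algebraicClosure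
  have hmem : ∀ z : k₂, (z : M) ∈
      algebraicClosure (IntermediateField.adjoin k (Set.range y)) M := by
    intro z
    rw [mem_algebraicClosure_iff]
    have := hk₂ z z.2
    rw [Subfield.closure_union_range_eq_adjoin] at this
    exact this
  exact AlgebraicIndependent.of_ringHom_of_comp_eq (k₂.subtype.codRestrict
    (algebraicClosure (IntermediateField.adjoin k (Set.range y)) M) hmem) (RingHom.id M) (x := x) h3
    (RingHom.injective _) rfl

/-- If a generating tuple (up to algebraic closure) of `F` over `C` is independent over `E ≥ C`,
then every tuple of `F` independent over `C` is independent over `E`. -/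
theorem AlgebraicIndependent.of_isAlgebraic_closure {C E F : Subfield M} (hCE : C ≤ E)
    (hCF : C ≤ F) {b : ι → M} (hb : AlgebraicIndependent E b)
    (hF : ∀ z ∈ F, IsAlgebraic (Subfield.closure ((C : Set M) ∪ Set.range b)) z)
    {x : ι' → M} (hx : AlgebraicIndependent C x) (hxF : ∀ i, x i ∈ F) :
    AlgebraicIndependent E x := by
  let _ := (Subfield.inclusion hCE).toAlgebra
  have : IsScalarTower C E M := .of_algebraMap_eq fun _ => rfl
  -- Two exchanges through a basis `s` of `E` over `C`: independence of `b` over `E` gives that of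
  -- `s` over `F`, which gives that of `x` over `E`.
  obtain ⟨s, hs⟩ := exists_isTranscendenceBasis C E
  have he : AlgebraicIndependent C fun i : s => ((i : E) : M) :=
    hs.1.map' (f := IsScalarTower.toAlgHom C E M) Subtype.val_injective
  have heF : AlgebraicIndependent F fun i : s => ((i : E) : M) :=
    he.exchange hCE (fun i => i.1.2) hb hF
  refine hx.exchange hCF hxF heF fun z hz => ?_
  have := hs.isAlgebraic_field.isAlgebraic (⟨z, hz⟩ : E)
  have h2 : IsAlgebraic (IntermediateField.adjoin C (Set.range fun i : s => (i : E))) (⟨z, hz⟩ : E) :=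
    this
  rw [Subfield.closure_union_range_eq_adjoin]
  have hle : (IntermediateField.adjoin C (Set.range fun i : s => (i : E))).map
      (IsScalarTower.toAlgHom C E M) = IntermediateField.adjoin C
        (Set.range fun i : s => ((i : E) : M)) := by
    rw [IntermediateField.adjoin_map, ← Set.range_comp]
    rfl
  let g : IntermediateField.adjoin C (Set.range fun i : s => (i : E)) →+*
      IntermediateField.adjoin C (Set.range fun i : s => ((i : E) : M)) :=
    (E.subtype.comp (algebraMap (IntermediateField.adjoin C (Set.range fun i : s => (i : E)))
      E)).codRestrict _ fun y => hle ▸ ⟨y.1, y.2, rfl⟩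
  exact h2.ringHom_of_comp_eq g E.subtype g.injective rfl

end AlgebraicIndependence

/-! ### Specialization of independent elements -/

section Specialization

/-- A ring homomorphism into an algebraically closed field extends along integral extensions. -/
theorem IsAlgClosed.exists_ringHom_comp_algebraMap_eq {Ω B C : Type*} [Field Ω] [IsAlgClosed Ω]
    [CommRing B] [CommRing C] [Algebra B C] [Algebra.IsIntegral B C]
    (hinj : Function.Injective (algebraMap B C)) (ε : B →+* Ω) :
    ∃ ε' : C →+* Ω, ε'.comp (algebraMap B C) = ε := by
  have hker : RingHom.ker (algebraMap B C) ≤ RingHom.ker ε := by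
    rw [(RingHom.injective_iff_ker_eq_bot _).1 hinj]
    exact bot_le
  have := RingHom.ker_isPrime ε
  -- Lying over: a prime `q` above `ker ε` makes `C ⧸ q` an algebraic extension of `B ⧸ ker ε`,
  -- which embeds in `Ω`.
  obtain ⟨q, -, hq, hqp⟩ :=
    Ideal.exists_ideal_over_prime_of_isIntegral (RingHom.ker ε) (⊥ : Ideal C) hker
  have : q.LiesOver (RingHom.ker ε) := ⟨hqp.symm⟩
  let _ : Algebra (B ⧸ RingHom.ker ε) Ω := (RingHom.kerLift ε).toAlgebra
  have hΩ : FaithfulSMul (B ⧸ RingHom.ker ε) Ω :=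
    (faithfulSMul_iff_algebraMap_injective _ _).2 (RingHom.kerLift_injective ε)
  have : Module.IsTorsionFree (B ⧸ RingHom.ker ε) Ω := inferInstance
  have : IsDomain (C ⧸ q) := Ideal.Quotient.isDomain q
  have : IsDomain (B ⧸ RingHom.ker ε) := Ideal.Quotient.isDomain _
  have : FaithfulSMul (B ⧸ RingHom.ker ε) (C ⧸ q) := inferInstance
  have : Module.IsTorsionFree (B ⧸ RingHom.ker ε) (C ⧸ q) := FaithfulSMul.to_isTorsionFree _ _
  have : Algebra.IsIntegral (B ⧸ RingHom.ker ε) (C ⧸ q) := inferInstance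
  have : Algebra.IsAlgebraic (B ⧸ RingHom.ker ε) (C ⧸ q) := inferInstance
  let f : (C ⧸ q) →ₐ[B ⧸ RingHom.ker ε] Ω := IsAlgClosed.lift
  refine ⟨(f : (C ⧸ q) →+* Ω).comp (Ideal.Quotient.mk q), RingHom.ext fun b => ?_⟩
  exact f.commutes (Ideal.Quotient.mk _ b)

open MvPolynomial in
/-- Given algebraically independent elements `s` over an algebraically closed field `Ω`, every
finite subset of the extension lies in a subring with an `Ω`-valued point sending `s` into a given
infinite set. -/
theorem AlgebraicIndependent.exists_specialization {Ω M : Type*} [Field Ω] [IsAlgClosed Ω]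
    [Field M] [Algebra Ω M] {s : Set M} (hs : AlgebraicIndependent Ω ((↑) : s → M)) {V : Set Ω}
    (hV : V.Infinite) (S : Finset M) :
    ∃ (A : Subalgebra Ω M) (ρ : A →ₐ[Ω] Ω), (S : Set M) ⊆ A ∧
      ∀ x ∈ s, ∃ h : x ∈ A, ρ ⟨x, h⟩ ∈ V := by
  obtain ⟨t, hst, ht⟩ := exists_isTranscendenceBasis_superset hs
  have halg := ht.isAlgebraic
  have hti : AlgebraicIndependent Ω ((↑) : t → M) := ht.1
  set B := Algebra.adjoin Ω (Set.range ((↑) : t → M))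
  -- A common denominator: `S` lies in the integral closure of `B` localized at `y`.
  obtain ⟨y, hy0, hy⟩ := Algebra.IsAlgebraic.exists_integral_multiples (R := B) (A := M) S
  have hrepr : hti.repr y ≠ 0 := fun h =>
    hy0 (Subtype.ext (by simpa [h] using (hti.aeval_repr y).symm))
  -- A nonzero polynomial cannot vanish on a grid with infinite sides, so the denominator survives
  -- at some point of `V ^ t`.
  obtain ⟨v, hvV, hv⟩ : ∃ v ∈ Set.pi Set.univ fun _ : t => V, eval v (hti.repr y) ≠ 0 := by
    by_contra! h
    exact hrepr (funext_set (fun _ : t => V) (fun _ => hV) (by simpa using h))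
  let ε : B →ₐ[Ω] Ω := (aeval v).comp (hti.repr : B →ₐ[Ω] MvPolynomial t Ω)
  have hε : ε y ≠ 0 := hv
  let C := integralClosure B M
  have hBC : Function.Injective (algebraMap B C) := by
    intro a b h
    exact Subtype.ext (congrArg (fun z : C => (z : M)) h)
  obtain ⟨ε', hε'⟩ := IsAlgClosed.exists_ringHom_comp_algebraMap_eq hBC (ε : B →+* Ω)
  have hε'' : ∀ b : B, ε' (algebraMap B C b) = ε b := fun b => RingHom.congr_fun hε' b
  let y' : C := algebraMap B C y
  have hy'M : (y' : M) ≠ 0 := by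
    intro h
    exact hy0 (Subtype.ext h)
  let R := Localization.Away y'
  let j : R →+* M := IsLocalization.Away.lift (g := C.toSubring.subtype) y' (IsUnit.mk0 _ hy'M)
  have hj : ∀ c : C, j (algebraMap C R c) = c := fun c =>
    IsLocalization.Away.lift_eq (g := C.toSubring.subtype) y' (IsUnit.mk0 _ hy'M) c
  let ρ : R →+* Ω := IsLocalization.Away.lift (g := ε') y' (by
    rw [hε'']; exact IsUnit.mk0 _ hε)
  have hρ : ∀ c : C, ρ (algebraMap C R c) = ε' c := fun c =>
    IsLocalization.Away.lift_eq (g := ε') y' _ c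
  have hjinj : Function.Injective j := by
    rw [injective_iff_map_eq_zero]
    intro r hr
    obtain ⟨n, c, hc⟩ := IsLocalization.Away.surj y' r
    have h1 : (c : M) = 0 := by rw [← hj, ← hc, map_mul, hr, zero_mul]
    have h2 : c = 0 := Subtype.ext h1
    rw [h2, map_zero] at hc
    exact ((IsLocalization.Away.algebraMap_isUnit (S := R) y').pow n).mul_left_eq_zero.1 hc
  have hΩR : ∀ a : Ω, j (algebraMap C R (algebraMap B C (algebraMap Ω B a))) = algebraMap Ω M a :=
    fun a => hj _
  let A : Subalgebra Ω M :=
    { j.range with algebraMap_mem' := fun a => ⟨_, hΩR a⟩ }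
  let e : R ≃+* j.range := RingEquiv.ofBijective j.rangeRestrict
    ⟨fun a b h => hjinj (congrArg Subtype.val h), j.rangeRestrict_surjective⟩
  have he : ∀ (r : R) (h : j r ∈ j.range), e.symm ⟨j r, h⟩ = r := fun r h => by
    rw [RingEquiv.symm_apply_eq]; rfl
  let ρA : A →+* Ω := ρ.comp (e.symm : j.range →+* R)
  have hρA : ∀ (r : R) (h : j r ∈ A), ρA ⟨j r, h⟩ = ρ r := fun r h => congrArg ρ (he r h)
  refine ⟨A, { ρA with commutes' := fun a => ?_ }, ?_, ?_⟩
  · have := hρA _ (hΩR a ▸ A.algebraMap_mem a)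
    rw [hρ, hε''] at this
    simp only [hΩR] at this
    exact this.trans (by simp)
  · intro z hz
    have hint : IsIntegral B (y • z) := hy z hz
    let c : C := ⟨y • z, hint⟩
    let u := (IsLocalization.Away.algebraMap_isUnit (S := R) y').unit
    refine ⟨algebraMap C R c * (u⁻¹ : Rˣ), ?_⟩
    have hu : j (u : R) = y' := hj y'
    have : j (u⁻¹ : Rˣ) * y' = 1 := by rw [← hu, ← map_mul, Units.inv_mul, map_one]
    rw [map_mul, hj]
    change ((y : M) * z) * j (u⁻¹ : Rˣ) = z
    calc ((y : M) * z) * j (u⁻¹ : Rˣ) = z * (j (u⁻¹ : Rˣ) * y) := by ring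
      _ = z := by rw [show (y : M) = y' from rfl, this, mul_one]
  · intro x hx
    let b : B := ⟨x, Algebra.subset_adjoin ⟨⟨x, hst hx⟩, rfl⟩⟩
    have hjx : j (algebraMap C R (algebraMap B C b)) = x := hj _
    have hxA : x ∈ A := ⟨_, hjx⟩
    refine ⟨hxA, ?_⟩
    have := hρA _ (hjx ▸ hxA)
    rw [hρ, hε''] at this
    simp only [hjx] at this
    have hb : hti.repr b = X ⟨x, hst hx⟩ := by
      exact hti.aevalEquiv.symm_apply_eq.2 (Subtype.ext (by simp [b]))
    have h2 : ε b = v ⟨x, hst hx⟩ := by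
      change aeval v (hti.repr b) = _
      rw [hb, aeval_X]
    change ρA ⟨x, hxA⟩ ∈ V
    rw [this, h2]
    exact hvV _ trivial

end Specialization

/-! ### Families that are eventually homomorphisms -/

section EventualHom

open Filter

/-- A family of maps `M → Ω` indexed by a filtered set which, on any given finite set of elements,
is eventually multiplicative, additive, and the identity on `Ω`. -/
structure IsEventualAlgHom {I Ω M : Type*} [Field Ω] [Field M] [Algebra Ω M] (l : Filter I)
    (ρ : I → M → Ω) : Prop where
  map_add : ∀ x y, ∀ᶠ i in l, ρ i (x + y) = ρ i x + ρ i y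
  map_mul : ∀ x y, ∀ᶠ i in l, ρ i (x * y) = ρ i x * ρ i y
  map_algebraMap : ∀ a, ∀ᶠ i in l, ρ i (algebraMap Ω M a) = a

theorem AlgebraicIndependent.exists_isEventualAlgHom {Ω M : Type*} [Field Ω] [IsAlgClosed Ω]
    [Field M] [Algebra Ω M] {s : Set M} (hs : AlgebraicIndependent Ω ((↑) : s → M)) {V : Set Ω}
    (hV : V.Infinite) :
    ∃ ρ : Finset M → M → Ω, IsEventualAlgHom atTop ρ ∧
      ∀ x ∈ s, ∀ᶠ S in atTop, ρ S x ∈ V := by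
  classical
  choose A r hA hr using hs.exists_specialization hV
  -- The value `0` outside `A S` is harmless: any given element lies in `A S` once `S` is large.
  let ρ : Finset M → M → Ω := fun S x => if h : x ∈ A S then r S ⟨x, h⟩ else 0
  have hρ : ∀ (S : Finset M) (x : M) (h : x ∈ A S), ρ S x = r S ⟨x, h⟩ := fun S x h => dif_pos h
  have hmem : ∀ x : M, ∀ᶠ S in atTop, x ∈ A S := fun x => by
    filter_upwards [eventually_ge_atTop {x}] with S hS
    exact hA S (hS (Finset.mem_singleton_self x))
  refine ⟨ρ, ⟨fun x y => ?_, fun x y => ?_, fun a => ?_⟩, fun x hx => ?_⟩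
  · filter_upwards [hmem x, hmem y] with S hx hy
    rw [hρ S x hx, hρ S y hy, hρ S _ (add_mem hx hy), ← _root_.map_add]
    rfl
  · filter_upwards [hmem x, hmem y] with S hx hy
    rw [hρ S x hx, hρ S y hy, hρ S _ (mul_mem hx hy), ← _root_.map_mul]
    rfl
  · exact .of_forall fun S => (hρ S _ ((A S).algebraMap_mem a)).trans ((r S).commutes a)
  · filter_upwards with S
    obtain ⟨h, hV⟩ := hr S x hx
    rwa [hρ S x h]

namespace IsEventualAlgHom

variable {I Ω M : Type*} [Field Ω] [Field M] [Algebra Ω M] {l : Filter I} {ρ : I → M → Ω}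
  (hρ : IsEventualAlgHom l ρ)
include hρ

theorem map_zero : ∀ᶠ i in l, ρ i 0 = 0 := by
  simpa using hρ.map_algebraMap 0

theorem map_one : ∀ᶠ i in l, ρ i 1 = 1 := by
  simpa using hρ.map_algebraMap 1

theorem map_neg (x : M) : ∀ᶠ i in l, ρ i (-x) = -ρ i x := by
  filter_upwards [hρ.map_zero, hρ.map_add x (-x)] with i h0 h
  rw [add_neg_cancel, h0] at h
  exact (neg_eq_of_add_eq_zero_right h.symm).symm

theorem map_inv (x : M) : ∀ᶠ i in l, ρ i x⁻¹ = (ρ i x)⁻¹ := by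
  by_cases hx : x = 0
  · filter_upwards [hρ.map_zero] with i h0
    rw [hx, inv_zero, h0, inv_zero]
  · filter_upwards [hρ.map_one, hρ.map_mul x x⁻¹] with i h1 h
    rw [mul_inv_cancel₀ hx, h1] at h
    exact eq_inv_of_mul_eq_one_right h.symm

theorem map_pow (x : M) (n : ℕ) : ∀ᶠ i in l, ρ i (x ^ n) = ρ i x ^ n := by
  induction n with
  | zero => simpa using hρ.map_one
  | succ n ih =>
    filter_upwards [ih, hρ.map_mul (x ^ n) x] with i h h'
    rw [pow_succ, h', h, pow_succ]

theorem map_sum {J : Type*} (s : Finset J) (g : J → M) :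
    ∀ᶠ i in l, ρ i (∑ j ∈ s, g j) = ∑ j ∈ s, ρ i (g j) := by
  classical
  induction s using Finset.induction_on with
  | empty => simpa using hρ.map_zero
  | insert a s ha ih =>
    filter_upwards [ih, hρ.map_add (g a) (∑ j ∈ s, g j)] with i h h'
    rw [Finset.sum_insert ha, Finset.sum_insert ha, h', h]

/-- The elements which are eventually mapped into a given subfield. -/
def eventuallyMem (R : Subfield Ω) : Subfield M where
  carrier := {x | ∀ᶠ i in l, ρ i x ∈ R}
  mul_mem' {x y} hx hy := by
    filter_upwards [hx, hy, hρ.map_mul x y] with i hx hy h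
    exact h ▸ mul_mem hx hy
  one_mem' := by
    filter_upwards [hρ.map_one] with i h
    exact h ▸ one_mem R
  add_mem' {x y} hx hy := by
    filter_upwards [hx, hy, hρ.map_add x y] with i hx hy h
    exact h ▸ add_mem hx hy
  zero_mem' := by
    filter_upwards [hρ.map_zero] with i h
    exact h ▸ zero_mem R
  neg_mem' {x} hx := by
    filter_upwards [hx, hρ.map_neg x] with i hx h
    exact h ▸ neg_mem hx
  inv_mem' x hx := by
    filter_upwards [hx, hρ.map_inv x] with i hx h
    exact h ▸ inv_mem hx

theorem mem_eventuallyMem {R : Subfield Ω} {x : M} :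
    x ∈ hρ.eventuallyMem R ↔ ∀ᶠ i in l, ρ i x ∈ R :=
  Iff.rfl

theorem eventuallyMem_mono {R R' : Subfield Ω} (h : R ≤ R') :
    hρ.eventuallyMem R ≤ hρ.eventuallyMem R' :=
  fun _ hx => Eventually.mono hx fun _ hi => h hi

-- The minimal polynomial is monic, so its coefficients specialize to a monic polynomial over `R`
-- with root `ρ i x`; algebraic closedness of `R` puts this root in `R`.
open Polynomial in
theorem mem_eventuallyMem_of_isAlgebraic {R : Subfield Ω} [IsAlgClosed R] {x : M}
    (hx : IsAlgebraic (hρ.eventuallyMem R) x) : x ∈ hρ.eventuallyMem R := by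
  set p := minpoly (hρ.eventuallyMem R) x with hp
  have hmonic : p.Monic := minpoly.monic hx.isIntegral
  have h0 : x ^ p.natDegree + ∑ j ∈ Finset.range p.natDegree, ((p.coeff j : M) * x ^ j) = 0 := by
    have h := minpoly.aeval (hρ.eventuallyMem R) x
    rw [← hp, hmonic.as_sum] at h
    simp only [_root_.map_add, _root_.map_pow, aeval_X, _root_.map_sum, _root_.map_mul,
      aeval_C] at h
    exact h
  have hcoeff : ∀ᶠ i in l, ∀ j ∈ Finset.range p.natDegree, ρ i (p.coeff j : M) ∈ R :=
    (Finset.eventually_all _).2 fun j _ => (p.coeff j).2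
  have hmul : ∀ᶠ i in l, ∀ j ∈ Finset.range p.natDegree,
      ρ i ((p.coeff j : M) * x ^ j) = ρ i (p.coeff j : M) * ρ i x ^ j :=
    (Finset.eventually_all _).2 fun j _ => by
      filter_upwards [hρ.map_mul (p.coeff j : M) (x ^ j), hρ.map_pow x j] with i h h'
      rw [h, h']
  rw [mem_eventuallyMem]
  filter_upwards [hcoeff, hmul, hρ.map_zero, hρ.map_pow x p.natDegree,
    hρ.map_add (x ^ p.natDegree) (∑ j ∈ Finset.range p.natDegree, ((p.coeff j : M) * x ^ j)),
    hρ.map_sum (Finset.range p.natDegree) fun j => (p.coeff j : M) * x ^ j]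
    with i hc hm hz hpow hadd hsum
  classical
  let a : ℕ → R := fun j => if h : ρ i (p.coeff j : M) ∈ R then ⟨_, h⟩ else 0
  let q : R[X] := X ^ p.natDegree + ∑ j ∈ Finset.range p.natDegree, C (a j) * X ^ j
  have hq : q.Monic := by
    refine monic_X_pow_add ((degree_sum_le _ _).trans_lt ?_)
    refine (Finset.sup_lt_iff (WithBot.bot_lt_coe _)).2 fun j hj => ?_
    exact (degree_C_mul_X_pow_le _ _).trans_lt (by exact_mod_cast Finset.mem_range.1 hj)
  have hroot : aeval (ρ i x) q = 0 := by
    have h1 : aeval (ρ i x) q =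
        ρ i x ^ p.natDegree + ∑ j ∈ Finset.range p.natDegree, (a j : Ω) * ρ i x ^ j := by
      simp [q]
      rfl
    rw [h1, ← hz, ← h0, hadd, hpow, hsum]
    congr 1
    refine Finset.sum_congr rfl fun j hj => ?_
    rw [hm j hj]
    simp only [a, dif_pos (hc j hj)]
  have hint : IsIntegral R (ρ i x) := ⟨q, hq, hroot⟩
  have := IntermediateField.eq_bot_of_isAlgClosed_of_isAlgebraic (algebraicClosure R Ω)
  obtain ⟨y, hy⟩ := IntermediateField.mem_bot.1
    (this ▸ (mem_algebraicClosure_iff.2 hint.isAlgebraic) : ρ i x ∈ (⊥ : IntermediateField R Ω))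
  exact hy ▸ y.2

/-- If eventually `E` is mapped into `K`, then `E` is linearly disjoint over `K` from `Ω`. -/
theorem linearIndependent [l.NeBot] {K : Subfield Ω} {E : Subfield M}
    (hE : E ≤ hρ.eventuallyMem K) {ι : Type*} {b : ι → Ω} (hb : LinearIndependent K b) :
    LinearIndependent E (algebraMap Ω M ∘ b) := by
  rw [linearIndependent_iff']
  intro s g hg i₀ hi₀
  by_contra hne
  -- Normalizing one coefficient to `1` keeps the specialized relation nontrivial.
  have hg' : ∑ i ∈ s, ((g i / g i₀ : E) : M) * algebraMap Ω M (b i) = 0 := by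
    have : ∑ i ∈ s, (g i : M) * algebraMap Ω M (b i) = 0 := hg
    simp_rw [Subfield.coe_div, div_mul_eq_mul_div]
    rw [← Finset.sum_div, this, zero_div]
  have hmul : ∀ᶠ n in l, ∀ i ∈ s, ρ n (((g i / g i₀ : E) : M) * algebraMap Ω M (b i)) =
      ρ n ((g i / g i₀ : E) : M) * b i :=
    (Finset.eventually_all _).2 fun i _ => by
      filter_upwards [hρ.map_mul ((g i / g i₀ : E) : M) (algebraMap Ω M (b i)),
        hρ.map_algebraMap (b i)] with n h h'
      rw [h, h']
  have hK : ∀ᶠ n in l, ∀ i ∈ s, ρ n ((g i / g i₀ : E) : M) ∈ K :=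
    (Finset.eventually_all _).2 fun i _ => hE (g i / g i₀ : E).2
  obtain ⟨n, hm, hk, h1, h0, hs⟩ := (hmul.and (hK.and (hρ.map_one.and (hρ.map_zero.and
    (hρ.map_sum s fun i => ((g i / g i₀ : E) : M) * algebraMap Ω M (b i)))))).exists
  rw [hg', h0, Finset.sum_congr rfl hm] at hs
  classical
  have := linearIndependent_iff'.1 hb s
    (fun i => if h : ρ n ((g i / g i₀ : E) : M) ∈ K then ⟨_, h⟩ else 0) (by
      rw [hs]
      refine Finset.sum_congr rfl fun i hi => ?_
      rw [dif_pos (hk i hi)]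
      rfl) i₀ hi₀
  rw [dif_pos (hk i₀ hi₀)] at this
  have h2 : ρ n ((g i₀ / g i₀ : E) : M) = 0 := congrArg Subtype.val this
  rw [div_self hne] at h2
  exact one_ne_zero (h1.symm.trans h2)

end IsEventualAlgHom

end EventualHom

/-! ### Gluing linearly disjoint fields -/

section Glue

open scoped TensorProduct

variable {M L : Type*} [Field M] [Field L]

/-- Two injective homomorphisms of a ring into fields induce a homomorphism between the
generated fields. -/
theorem Subfield.exists_ringHom_closure_range {R : Type*} [CommRing R] {i : R →+* M}
    (hi : Function.Injective i) {j : R →+* L} (hj : Function.Injective j) :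
    ∃ χ : Subfield.closure (Set.range i) →+* L,
      ∀ r, χ ⟨i r, Subfield.subset_closure ⟨r, rfl⟩⟩ = j r := by
  have : IsDomain R := hi.isDomain i
  let I : FractionRing R →+* M := IsFractionRing.lift hi
  let J : FractionRing R →+* L := IsFractionRing.lift hj
  have hI : ∀ r, I (algebraMap R _ r) = i r := IsFractionRing.lift_algebraMap hi
  have hJ : ∀ r, J (algebraMap R _ r) = j r := IsFractionRing.lift_algebraMap hj
  have hle : Subfield.closure (Set.range i) ≤ I.fieldRange := by
    rw [Subfield.closure_le]
    rintro _ ⟨r, rfl⟩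
    exact ⟨_, hI r⟩
  let e : FractionRing R ≃+* I.fieldRange := I.rangeRestrictFieldEquiv
  refine ⟨J.comp ((e.symm : I.fieldRange →+* FractionRing R).comp (Subfield.inclusion hle)),
    fun r => ?_⟩
  have : e.symm ⟨i r, hle (Subfield.subset_closure ⟨r, rfl⟩)⟩ = algebraMap R _ r := by
    rw [RingEquiv.symm_apply_eq]
    exact Subtype.ext (hI r).symm
  exact (congrArg J this).trans (hJ r)

/-- The `1 ⊗ b i` form an `E`-basis of `E ⊗ F`, and the map sends them to the independent family `φ
∘ b`. -/
theorem Algebra.TensorProduct.lift_injective_of_linearIndependent {K E F : Type*} [Field K]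
    [Field E] [Field F] [Algebra K E] [Algebra K F] [Algebra K M] [Algebra E M]
    [IsScalarTower K E M] (φ : F →ₐ[K] M) {ι : Type*} (b : Module.Basis ι K F)
    (hb : LinearIndependent E (φ ∘ b)) :
    Function.Injective
      (Algebra.TensorProduct.lift (Algebra.ofId E M) φ fun _ _ => Commute.all _ _) := by
  set f := Algebra.TensorProduct.lift (Algebra.ofId E M) φ fun _ _ => Commute.all _ _
  let B := Algebra.TensorProduct.basis E b
  have hf : f.toLinearMap = (Finsupp.linearCombination E (φ ∘ b)) ∘ₗ B.repr.toLinearMap := by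
    refine B.ext fun i => ?_
    simp [B, f]
  have : Function.Injective f.toLinearMap := by
    rw [hf, LinearMap.coe_comp]
    exact Function.Injective.comp hb B.repr.injective
  exact this

/-- Two fields which are linearly disjoint in the source and in the target can be mapped
independently, as soon as the maps agree on the common subfield. -/
theorem Subfield.exists_ringHom_closure_union {F : Type*} [Field F] (K : Subfield F)
    (E : Subfield M) (φ : F →+* M) (φ' : F →+* L) (ψ : E →+* L)
    (hK : ∀ x ∈ K, ∃ h : φ x ∈ E, ψ ⟨φ x, h⟩ = φ' x) {ι : Type*} (b : Module.Basis ι K F)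
    (hM : LinearIndependent E (φ ∘ b)) (hL : LinearIndependent ψ.fieldRange (φ' ∘ b)) :
    ∃ χ : Subfield.closure ((E : Set M) ∪ Set.range φ) →+* L,
      (∀ e : E, χ ⟨e, Subfield.subset_closure (Or.inl e.2)⟩ = ψ e) ∧
      ∀ x, χ ⟨φ x, Subfield.subset_closure (Or.inr ⟨x, rfl⟩)⟩ = φ' x := by
  let _ : Algebra K E := ((φ.comp K.subtype).codRestrict E fun x => (hK x x.2).1).toAlgebra
  let _ : Algebra K M := (φ.comp K.subtype).toAlgebra
  have : IsScalarTower K E M := .of_algebraMap_eq fun _ => rfl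
  let _ : Algebra E L := ψ.toAlgebra
  let _ : Algebra K L := (φ'.comp K.subtype).toAlgebra
  have : IsScalarTower K E L := .of_algebraMap_eq fun x => (hK x x.2).2.symm
  let φK : F →ₐ[K] M := { φ with commutes' := fun _ => rfl }
  let φK' : F →ₐ[K] L := { φ' with commutes' := fun _ => rfl }
  have hL' : LinearIndependent E (φK' ∘ b) := by
    rw [linearIndependent_iff'] at hL ⊢
    intro s g hg i hi
    have := hL s (fun i => ψ.rangeRestrictField (g i)) hg i hi
    exact ψ.rangeRestrictField.injective (this.trans (map_zero _).symm)
  -- By linear disjointness `E ⊗ F` over `K` embeds in both `M` and `L`, so its fraction field does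
  -- too.
  obtain ⟨χ, hχ⟩ := Subfield.exists_ringHom_closure_range
    (i := (Algebra.TensorProduct.lift (Algebra.ofId E M) φK fun _ _ => Commute.all _ _).toRingHom)
    (Algebra.TensorProduct.lift_injective_of_linearIndependent φK b hM)
    (j := (Algebra.TensorProduct.lift (Algebra.ofId E L) φK' fun _ _ => Commute.all _ _).toRingHom)
    (Algebra.TensorProduct.lift_injective_of_linearIndependent φK' b hL')
  have h₁ : ∀ e : E, (Algebra.TensorProduct.lift (Algebra.ofId E M) φK
      fun _ _ => Commute.all _ _).toRingHom (e ⊗ₜ 1) = e := fun e => by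
    simp [Algebra.ofId_apply]; rfl
  have h₂ : ∀ x : F, (Algebra.TensorProduct.lift (Algebra.ofId E M) φK
      fun _ _ => Commute.all _ _).toRingHom (1 ⊗ₜ x) = φ x := fun x => by
    simp; rfl
  have h₁' : ∀ e : E, (Algebra.TensorProduct.lift (Algebra.ofId E L) φK'
      fun _ _ => Commute.all _ _).toRingHom (e ⊗ₜ 1) = ψ e := fun e => by
    simp [Algebra.ofId_apply]; rfl
  have h₂' : ∀ x : F, (Algebra.TensorProduct.lift (Algebra.ofId E L) φK'
      fun _ _ => Commute.all _ _).toRingHom (1 ⊗ₜ x) = φ' x := fun x => by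
    simp; rfl
  have hle : Subfield.closure ((E : Set M) ∪ Set.range φ) ≤ Subfield.closure (Set.range
      (Algebra.TensorProduct.lift (Algebra.ofId E M) φK fun _ _ => Commute.all _ _).toRingHom) := by
    refine Subfield.closure_mono (Set.union_subset (fun e he => ⟨_, h₁ ⟨e, he⟩⟩) ?_)
    rintro _ ⟨x, rfl⟩
    exact ⟨_, h₂ x⟩
  refine ⟨χ.comp (Subfield.inclusion hle), fun e => ?_, fun x => ?_⟩
  · rw [← h₁' e, ← hχ]
    exact congrArg χ (Subtype.ext (h₁ e).symm)
  · rw [← h₂' x, ← hχ]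
    exact congrArg χ (Subtype.ext (h₂ x).symm)

end Glue

/-! ### Systems of fields and uniqueness of realizations -/

/-- A system of algebraically closed fields indexed by a preorder, with generators for each field,
up to algebraic closure, over the images of the previous ones. -/
structure FieldSystem (P : Type) [Preorder P] where
  obj : P → Type u
  [field : ∀ d, Field (obj d)]
  [isAlgClosed : ∀ d, IsAlgClosed (obj d)]
  map : ∀ {d e : P}, d ≤ e → obj d →+* obj e
  map_map : ∀ {c d e : P} (h : c ≤ d) (h' : d ≤ e) (x : obj c),
    map h' (map h x) = map (h.trans h') x
  map_refl : ∀ (d : P) (x : obj d), map le_rfl x = x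
  gen : ∀ d, Set (obj d)
  isAlgebraic : ∀ (d : P) (x : obj d), IsAlgebraic (Subfield.closure
    ((⋃ (e : P) (h : e < d), Set.range (map h.le)) ∪ gen d)) x

namespace FieldSystem

attribute [instance] FieldSystem.field FieldSystem.isAlgClosed

/-- A compatible family of embeddings of a system into a field `M`, such that the generators of
each `obj c` are algebraically independent over the images of all `obj d` with `c ≰ d`. -/
structure Realization {P : Type} [Preorder P] (F : FieldSystem.{u} P) (M : Type*) [Field M] where
  hom : ∀ d, F.obj d →+* M
  hom_map : ∀ {d e : P} (h : d ≤ e) (x : F.obj d), hom e (F.map h x) = hom d x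
  indep : ∀ c, AlgebraicIndependent
    (Subfield.closure (⋃ (d : P) (_ : ¬ c ≤ d), Set.range (hom d))) fun x : F.gen c => hom c x

namespace Realization

variable {P : Type} {M L : Type*} [Field M] [Field L]

/-- The subfield generated by the images of the `obj d` for `d ∈ J`. -/
def span [Preorder P] {F : FieldSystem.{u} P} (R : F.Realization M) (J : Set P) : Subfield M :=
  Subfield.closure (⋃ d ∈ J, Set.range (R.hom d))

section Preorder

variable [Preorder P] {F : FieldSystem.{u} P} (R : F.Realization M)

theorem hom_mem_span {J : Set P} {d : P} (hd : d ∈ J) (x : F.obj d) : R.hom d x ∈ R.span J :=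
  Subfield.subset_closure (Set.mem_biUnion hd ⟨x, rfl⟩)

theorem span_le {J : Set P} {K : Subfield M} : R.span J ≤ K ↔ ∀ d ∈ J, ∀ x, R.hom d x ∈ K := by
  simp [span, Subfield.closure_le, Set.iUnion_subset_iff, Set.range_subset_iff]

theorem indep_span (c : P) :
    AlgebraicIndependent (R.span {d | ¬ c ≤ d}) fun x : F.gen c => R.hom c x :=
  R.indep c

end Preorder

/-- Remove a maximal `d` from `D`. Neither `c` nor the remaining indices lie above `d`, so `gen d`
is independent over a field containing `F_c` and the other generators; independence in towers
concludes. -/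
theorem algebraicIndependent_biUnion [PartialOrder P] {F : FieldSystem.{u} P}
    (R : F.Realization M) (c : P) (D : Finset P) (hD : ∀ d ∈ D, ¬ d ≤ c) :
    AlgebraicIndependent (R.hom c).fieldRange
      ((↑) : (⋃ d ∈ D, R.hom d '' F.gen d : Set M) → M) := by
  classical
  induction D using Finset.strongInduction with
  | H D ih =>
  rcases D.eq_empty_or_nonempty with rfl | hne
  · have : IsEmpty (⋃ d ∈ (∅ : Finset P), R.hom d '' F.gen d : Set M) := by simp
    exact algebraicIndependent_empty_type
  obtain ⟨d, hd⟩ := D.exists_maximal hne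
  have hx := ih (D.erase d) (Finset.erase_ssubset hd.1)
    fun e he => hD e (Finset.mem_of_mem_erase he)
  have hle : (R.hom c).fieldRange ≤ R.span {e | ¬ d ≤ e} := by
    rintro _ ⟨x, rfl⟩
    exact R.hom_mem_span (hD d hd.1) x
  let _ := (Subfield.inclusion hle).toAlgebra
  have : IsScalarTower (R.hom c).fieldRange (R.span {e | ¬ d ≤ e}) M :=
    .of_algebraMap_eq fun _ => rfl
  have hsum := hx.sumElim_of_tower (S := R.span {e | ¬ d ≤ e}) ?_ (R.indep_span d)
  · refine hsum.to_subtype_range' ?_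
    rw [Set.Sum.elim_range, Subtype.range_coe]
    conv_rhs => rw [← Finset.insert_erase hd.1, Finset.set_biUnion_insert]
    rw [Set.image_eq_range]
  · rw [Subtype.range_coe]
    intro z hz
    simp only [Set.mem_iUnion] at hz
    obtain ⟨e, he, x, -, rfl⟩ := hz
    have : ¬ d ≤ e := fun h => (Finset.ne_of_mem_erase he)
      (le_antisymm (hd.2 (Finset.mem_of_mem_erase he) h) h)
    exact ⟨⟨_, R.hom_mem_span this x⟩, rfl⟩

variable [SemilatticeInf P] [OrderBot P] [Finite P] {F : FieldSystem.{u} P}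

/-- Linear disjointness of `obj c` and the field generated by a family of the `obj d`, over the
field generated by the `obj (d ⊓ c)`. -/
theorem linearIndependent_span (R : F.Realization M) (J : Set P) (c : P) {ι : Type*}
    {b : ι → F.obj c} (hb : LinearIndependent (Subfield.closure
      (⋃ d ∈ J, Set.range (F.map (inf_le_right : d ⊓ c ≤ c)))) b) :
    LinearIndependent (R.span J) (R.hom c ∘ b) := by
  classical
  let _ : Algebra (F.obj c) M := (R.hom c).toAlgebra
  obtain ⟨D, hD⟩ : ∃ D : Finset P, ∀ d, d ∈ D ↔ ¬ d ≤ c :=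
    ⟨(Set.toFinite {d | ¬ d ≤ c}).toFinset, fun d => by simp⟩
  have hs : AlgebraicIndependent (F.obj c)
      ((↑) : (⋃ d ∈ D, R.hom d '' F.gen d : Set M) → M) :=
    (R.algebraicIndependent_biUnion c D fun d => (hD d).1).of_ringHom_of_comp_eq
      (R.hom c).rangeRestrictField (RingHom.id M) (R.hom c).rangeRestrictField.injective rfl
  -- The values are taken in the image of `F_⊥` because it is infinite and contained in the image of
  -- every `F_(d ⊓ c)`.
  obtain ⟨ρ, hρ, hV⟩ := hs.exists_isEventualAlgHom
    (V := Set.range (F.map (bot_le : ⊥ ≤ c)))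
    (Set.infinite_range_of_injective (F.map (bot_le : ⊥ ≤ c)).injective)
  have key : ∀ (d : P) (x : F.obj d),
      R.hom d x ∈ hρ.eventuallyMem (F.map (inf_le_right : d ⊓ c ≤ c)).fieldRange := by
    intro d
    induction d using WellFoundedLT.induction with
    | ind d ih =>
    intro x
    by_cases hdc : d ≤ c
    · rw [← R.hom_map hdc, hρ.mem_eventuallyMem]
      filter_upwards [hρ.map_algebraMap (F.map hdc x)] with i hi
      exact hi.symm ▸ ⟨F.map (le_inf le_rfl hdc) x, F.map_map _ _ x⟩
    -- `F_d` is algebraic over its generators, sent into `F_⊥`, and the `F_e` with `e < d`, sent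
    -- into `F_(e ⊓ c)` by induction.
    · have : IsAlgClosed (F.map (inf_le_right : d ⊓ c ≤ c)).fieldRange :=
        IsAlgClosed.of_ringEquiv _ _ (F.map (inf_le_right : d ⊓ c ≤ c)).rangeRestrictFieldEquiv
      refine hρ.mem_eventuallyMem_of_isAlgebraic
        (isAlgebraic_subfield_mono ?_ ((F.isAlgebraic d x).subfield_map (R.hom d)))
      rw [Subfield.map_le_iff_le_comap, Subfield.closure_le]
      refine Set.union_subset (Set.iUnion₂_subset fun e he => ?_) fun g hg => ?_
      · rintro _ ⟨y, rfl⟩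
        change R.hom d _ ∈ hρ.eventuallyMem (F.map (inf_le_right : d ⊓ c ≤ c)).fieldRange
        rw [R.hom_map]
        refine hρ.eventuallyMem_mono ?_ (ih e he y)
        rintro _ ⟨z, rfl⟩
        exact ⟨F.map (inf_le_inf_right c he.le) z, F.map_map _ _ z⟩
      · have hmem : R.hom d g ∈ (⋃ d ∈ D, R.hom d '' F.gen d : Set M) :=
          Set.mem_biUnion ((hD d).2 hdc) ⟨g, hg, rfl⟩
        change ∀ᶠ i in _, _
        filter_upwards [hV _ hmem] with i hi
        obtain ⟨z, hz⟩ := hi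
        exact ⟨F.map bot_le z, (F.map_map _ _ z).trans hz⟩
  refine hρ.linearIndependent ((R.span_le).2 fun d hd x => ?_) hb
  refine hρ.eventuallyMem_mono ?_ (key d x)
  rintro _ ⟨z, rfl⟩
  exact Subfield.subset_closure (Set.mem_biUnion hd ⟨z, rfl⟩)

/-- Uniqueness of realizations: the fields generated by the images of a lower set of indices
in two realizations are isomorphic. -/
theorem exists_ringHom_span (R : F.Realization M) (R' : F.Realization L) (J : Finset P)
    (hJ : IsLowerSet (J : Set P)) (hbot : ⊥ ∈ J) :
    ∃ χ : R.span J →+* L, ∀ (d : P) (hd : d ∈ J) (x : F.obj d),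
      χ ⟨R.hom d x, R.hom_mem_span (Finset.mem_coe.2 hd) x⟩ = R'.hom d x := by
  classical
  induction J using Finset.strongInduction with
  | H J ih =>
  obtain ⟨c, hc⟩ := J.exists_maximal ⟨_, hbot⟩
  by_cases hcbot : c = ⊥
  · have hle : R.span J ≤ (R.hom ⊥).fieldRange := by
      refine R.span_le.2 fun d hd x => ?_
      have hd' : d ≤ ⊥ := hcbot ▸ hc.2 hd (hcbot ▸ bot_le)
      exact ⟨F.map hd' x, R.hom_map _ _⟩
    let e : F.obj ⊥ ≃+* (R.hom ⊥).fieldRange := (R.hom ⊥).rangeRestrictFieldEquiv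
    refine ⟨((R'.hom ⊥).comp (e.symm : (R.hom ⊥).fieldRange →+* F.obj ⊥)).comp
      (Subfield.inclusion hle), fun d hd x => ?_⟩
    have hd' : d ≤ ⊥ := hcbot ▸ hc.2 (Finset.mem_coe.2 hd) (hcbot ▸ bot_le)
    have : e.symm ⟨R.hom d x, hle (R.hom_mem_span hd x)⟩ = F.map hd' x := by
      rw [RingEquiv.symm_apply_eq]
      exact Subtype.ext (R.hom_map _ _).symm
    exact (congrArg (R'.hom ⊥) this).trans (R'.hom_map _ _)
  have hsub : ∀ d ∈ J, d ≠ c → d ∈ J.erase c := fun d hd hdc => Finset.mem_erase.2 ⟨hdc, hd⟩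
  have hlow : IsLowerSet ((J.erase c : Finset P) : Set P) := by
    intro d e hed hd
    refine hsub e (hJ hed (Finset.mem_of_mem_erase hd)) ?_
    rintro rfl
    exact Finset.ne_of_mem_erase hd
      (le_antisymm (hc.2 (Finset.mem_of_mem_erase hd) hed) hed)
  obtain ⟨ψ, hψ⟩ := ih (J.erase c) (Finset.erase_ssubset hc.1) hlow
    (hsub _ hbot (Ne.symm hcbot))
  let J' : Set P := ((J.erase c : Finset P) : Set P)
  let K : Subfield (F.obj c) := Subfield.closure
    (⋃ d ∈ J', Set.range (F.map (inf_le_right : d ⊓ c ≤ c)))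
  have hKE : ∀ x ∈ K, R.hom c x ∈ R.span J' := by
    suffices K ≤ (R.span J').comap (R.hom c) from this
    rw [Subfield.closure_le]
    refine Set.iUnion₂_subset fun d hd => ?_
    rintro _ ⟨y, rfl⟩
    change R.hom c _ ∈ R.span J'
    rw [R.hom_map]
    exact R.hom_mem_span (hlow inf_le_left hd) y
  have hK : ∀ x ∈ K, ∃ h : R.hom c x ∈ R.span J', ψ ⟨R.hom c x, h⟩ = R'.hom c x := by
    intro x hx
    refine ⟨hKE x hx, ?_⟩
    let g : K →+* L := ψ.comp (((R.hom c).comp K.subtype).codRestrict _ fun y => hKE y y.2)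
    -- The two maps agree on a subfield, so agreement on the generators `F_(d ⊓ c)` of `K` suffices.
    let S : Subfield K := g.eqLocusField ((R'.hom c).comp K.subtype)
    have hS : K ≤ S.map K.subtype := by
      rw [Subfield.closure_le]
      refine Set.iUnion₂_subset fun d hd => ?_
      rintro _ ⟨y, rfl⟩
      refine ⟨⟨F.map inf_le_right y, Subfield.subset_closure (Set.mem_biUnion hd ⟨y, rfl⟩)⟩, ?_, rfl⟩
      have h₁ : (⟨R.hom c (F.map inf_le_right y), hKE _ (Subfield.subset_closure
          (Set.mem_biUnion hd ⟨y, rfl⟩))⟩ : R.span J') =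
          ⟨R.hom (d ⊓ c) y, R.hom_mem_span (hlow inf_le_left hd) y⟩ :=
        Subtype.ext (R.hom_map _ _)
      exact (congrArg ψ h₁).trans
        ((hψ _ (hlow inf_le_left hd) y).trans (R'.hom_map _ _).symm)
    obtain ⟨y, hy, rfl⟩ := hS hx
    exact hy
  let b := Module.Basis.ofVectorSpace K (F.obj c)
  -- Linear disjointness in the target is known over `R'.span J'` and is needed over the range of
  -- `ψ`.
  have hrange : ψ.fieldRange ≤ R'.span J' := by
    let T : Subfield (R.span J') := (R'.span J').comap ψ
    have hT : R.span J' ≤ T.map (R.span J').subtype := by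
      refine R.span_le.2 fun d hd x => ⟨⟨_, R.hom_mem_span hd x⟩, ?_, rfl⟩
      change ψ ⟨R.hom d x, _⟩ ∈ R'.span J'
      rw [hψ d hd x]
      exact R'.hom_mem_span hd x
    rintro _ ⟨z, rfl⟩
    obtain ⟨y, hy, hyz⟩ := hT z.2
    rw [← show y = z from Subtype.ext hyz]
    exact hy
  have hL : LinearIndependent ψ.fieldRange (R'.hom c ∘ b) := by
    have h := R'.linearIndependent_span J' c b.linearIndependent
    rw [linearIndependent_iff'] at h ⊢
    intro s g hg i hi
    have := h s (fun i => Subfield.inclusion hrange (g i)) hg i hi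
    exact (Subfield.inclusion hrange).injective (this.trans (map_zero _).symm)
  obtain ⟨χ, hχ₁, hχ₂⟩ := Subfield.exists_ringHom_closure_union K (R.span J') (R.hom c) (R'.hom c) ψ
    hK b (R.linearIndependent_span J' c b.linearIndependent) hL
  have hle : R.span J ≤ Subfield.closure ((R.span J' : Set M) ∪ Set.range (R.hom c)) := by
    refine R.span_le.2 fun d hd x => Subfield.subset_closure ?_
    by_cases hdc : d = c
    · subst hdc
      exact Or.inr ⟨x, rfl⟩
    · exact Or.inl (R.hom_mem_span (hsub d hd hdc) x)
  refine ⟨χ.comp (Subfield.inclusion hle), fun d hd x => ?_⟩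
  by_cases hdc : d = c
  · subst hdc
    exact hχ₂ x
  · exact (hχ₁ ⟨_, R.hom_mem_span (hsub d hd hdc) x⟩).trans (hψ d (hsub d hd hdc) x)

end Realization

end FieldSystem

/-! ### Existence of realizations -/

theorem IsTranscendenceBasis.exists_algHom_of_isAlgClosed {K E Ω ι : Type*} [Field K] [Field E]
    [Field Ω] [IsAlgClosed Ω] [Algebra K E] [Algebra K Ω] {x : ι → E}
    (hx : IsTranscendenceBasis K x) {y : ι → Ω} (hy : AlgebraicIndependent K y) :
    ∃ φ : E →ₐ[K] Ω, ∀ i, φ (x i) = y i := by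
  have halg := hx.isAlgebraic
  have hxi : AlgebraicIndependent K x := hx.1
  let g : Algebra.adjoin K (Set.range x) →ₐ[K] Ω :=
    (MvPolynomial.aeval y).comp (hxi.repr : _ →ₐ[K] MvPolynomial ι K)
  have hg : Function.Injective g :=
    (algebraicIndependent_iff_injective_aeval.1 hy).comp hxi.aevalEquiv.symm.injective
  let _ : Algebra (Algebra.adjoin K (Set.range x)) Ω := (g : _ →+* Ω).toAlgebra
  have : FaithfulSMul (Algebra.adjoin K (Set.range x)) Ω :=
    (faithfulSMul_iff_algebraMap_injective _ _).2 hg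
  have : Module.IsTorsionFree (Algebra.adjoin K (Set.range x)) Ω :=
    FaithfulSMul.to_isTorsionFree _ _
  let φ : E →ₐ[Algebra.adjoin K (Set.range x)] Ω := IsAlgClosed.lift
  refine ⟨{ (φ : E →+* Ω) with commutes' := fun a => ?_ }, fun i => ?_⟩
  · exact (φ.commutes (algebraMap K _ a)).trans (g.commutes a)
  · have h := φ.commutes (⟨x i, Algebra.subset_adjoin ⟨i, rfl⟩⟩ : Algebra.adjoin K (Set.range x))
    refine h.trans ?_
    change MvPolynomial.aeval y (hxi.aevalEquiv.symm _) = y i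
    rw [show hxi.aevalEquiv.symm ⟨x i, Algebra.subset_adjoin ⟨i, rfl⟩⟩ = MvPolynomial.X i from
      hxi.aevalEquiv.symm_apply_eq.2 (Subtype.ext (by simp)), MvPolynomial.aeval_X]

/-- Every field embeds in an algebraically closed field with a given number of algebraically
independent elements. -/
theorem exists_isAlgClosed_algebraicIndependent (L ι : Type u) [Field L] :
    ∃ (L' : Type u) (_ : Field L') (_ : IsAlgClosed L') (σ : L →+* L') (y : ι → L'),
      AlgebraicIndependent σ.fieldRange y := by
  let E := FractionRing (MvPolynomial ι L)
  let L' := AlgebraicClosure E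
  have h₁ : AlgebraicIndependent L (algebraMap (MvPolynomial ι L) L' ∘ MvPolynomial.X) :=
    (MvPolynomial.algebraicIndependent_X ι L).map'
      (f := IsScalarTower.toAlgHom L (MvPolynomial ι L) L')
      ((FaithfulSMul.algebraMap_injective E L').comp (IsFractionRing.injective (MvPolynomial ι L) E))
  exact ⟨L', inferInstance, inferInstance, algebraMap L L', _,
    h₁.ringHom_of_comp_eq (algebraMap L L').rangeRestrictField (RingHom.id L')
      (RingHom.rangeRestrictField_bijective _).2 Function.injective_id rfl⟩

namespace FieldSystem

variable {P : Type}

/-- The restriction of a system to a lower set. -/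
def restrict [Preorder P] (F : FieldSystem.{u} P) {J : Set P} (hJ : IsLowerSet J) :
    FieldSystem.{u} J where
  obj d := F.obj d
  map h := F.map h
  map_map h h' x := F.map_map (Subtype.coe_le_coe.2 h) (Subtype.coe_le_coe.2 h') x
  map_refl d x := F.map_refl d x
  gen d := F.gen d
  isAlgebraic d x := by
    refine isAlgebraic_subfield_mono (Subfield.closure_mono ?_) (F.isAlgebraic d x)
    refine Set.union_subset_union_left _ (Set.iUnion₂_subset fun e he => ?_)
    exact Set.subset_iUnion₂_of_subset (⟨e, hJ he.le d.2⟩ : J) he subset_rfl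

/-- The system is independent: for each `a`, the maps into `obj a` are a realization. -/
def IsIndependent [Preorder P] (F : FieldSystem.{u} P) : Prop :=
  ∀ (a c : P) (h : c ≤ a), AlgebraicIndependent
    (Subfield.closure (⋃ (d : P) (hd : d ≤ a) (_ : ¬ c ≤ d), Set.range (F.map hd)))
    fun x : F.gen c => F.map h x

/-- In an independent system, the maps into `obj a` form a realization of a lower set of indices
below `a`. -/
def IsIndependent.realization [Preorder P] {F : FieldSystem.{u} P} (hF : F.IsIndependent)
    {J : Set P} (hJ : IsLowerSet J) (a : P) (ha : ∀ d ∈ J, d ≤ a) :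
    (F.restrict hJ).Realization (F.obj a) where
  hom d := F.map (ha d d.2)
  hom_map h x := F.map_map (Subtype.coe_le_coe.2 h) _ x
  indep c := (hF a c (ha c c.2)).subfield_mono <| Subfield.closure_mono <| by
    intro z hz
    obtain ⟨d, hcd, hz⟩ := Set.mem_iUnion₂.1 hz
    exact Set.mem_iUnion₂.2 ⟨d, ha d d.2, Set.mem_iUnion.2 ⟨hcd, hz⟩⟩

/-- Restriction of a realization to a smaller lower set. -/
def Realization.restrict [Preorder P] {F : FieldSystem.{u} P} {L : Type*} [Field L] {J J' : Set P}
    {hJ : IsLowerSet J} (R : (F.restrict hJ).Realization L) (hJ' : IsLowerSet J') (h : J' ⊆ J) :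
    (F.restrict hJ').Realization L where
  hom d := R.hom ⟨d, h d.2⟩
  hom_map {d e} hde x := R.hom_map (d := ⟨d, h d.2⟩) (e := ⟨e, h e.2⟩) hde x
  indep c := (R.indep ⟨c, h c.2⟩).subfield_mono <| Subfield.closure_mono <| by
    intro z hz
    obtain ⟨d, hcd, hz⟩ := Set.mem_iUnion₂.1 hz
    exact Set.mem_iUnion₂.2 ⟨⟨d, h d.2⟩, hcd, hz⟩

variable [SemilatticeInf P] [OrderBot P] [Finite P] {F : FieldSystem.{u} P}

/-- A realization of the part of an independent system strictly below `c` agrees, on the field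
generated by this part in `obj c`, with an embedding. -/
theorem IsIndependent.exists_ringHom_closure (hF : F.IsIndependent) (c : P) (hc : c ≠ ⊥)
    {L : Type*} [Field L] (R : (F.restrict (isLowerSet_Iio c)).Realization L) :
    ∃ χ : Subfield.closure (⋃ (d : P) (h : d < c), Set.range (F.map h.le)) →+* L,
      ∀ (d : P) (h : d < c) (x : F.obj d), χ ⟨F.map h.le x, Subfield.subset_closure
        (Set.mem_iUnion₂.2 ⟨d, h, x, rfl⟩)⟩ = R.hom ⟨d, h⟩ x := by
  classical
  have hbot : ⊥ < c := bot_lt_iff_ne_bot.2 hc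
  let _ : SemilatticeInf (Set.Iio c) := Subtype.semilatticeInf fun _ _ hx _ => inf_le_left.trans_lt hx
  let _ : OrderBot (Set.Iio c) := Subtype.orderBot hbot
  have _ : Fintype (Set.Iio c) := Fintype.ofFinite _
  -- `F.obj c` itself realizes the part below `c`; uniqueness compares this realization with `R`.
  let R₀ := hF.realization (isLowerSet_Iio c) c fun d hd => le_of_lt hd
  obtain ⟨χ, hχ⟩ := Realization.exists_ringHom_span (P := Set.Iio c) R₀ R Finset.univ
    (fun _ _ _ _ => by simp) (Finset.mem_univ _)
  have hle : Subfield.closure (⋃ (d : P) (h : d < c), Set.range (F.map h.le)) ≤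
      R₀.span ((Finset.univ : Finset (Set.Iio c)) : Set (Set.Iio c)) := by
    rw [Subfield.closure_le]
    refine Set.iUnion₂_subset fun d hd => ?_
    rintro _ ⟨x, rfl⟩
    exact R₀.hom_mem_span (d := ⟨d, hd⟩) (by simp) x
  exact ⟨χ.comp (Subfield.inclusion hle), fun d hd x => hχ ⟨d, hd⟩ (Finset.mem_univ _) x⟩

/-- Extension of a realization of a lower set by one index. -/
theorem IsIndependent.exists_realization_of_erase [DecidableEq P] (hF : F.IsIndependent)
    {J : Finset P} (hJ : IsLowerSet (J : Set P)) {c : P} (hc : Maximal (· ∈ J) c) (hcbot : c ≠ ⊥)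
    (hJ' : IsLowerSet ((J.erase c : Finset P) : Set P)) {L : Type u} [Field L]
    (R : (F.restrict hJ').Realization L) :
    ∃ (L' : Type u) (_ : Field L') (_ : IsAlgClosed L'),
      Nonempty ((F.restrict hJ).Realization L') := by
  have hmem : ∀ {d}, d ∈ J → d ≠ c → d ∈ ((J.erase c : Finset P) : Set P) := fun hd hdc =>
    Finset.mem_coe.2 (Finset.mem_erase.2 ⟨hdc, hd⟩)
  have hlt : ∀ {d}, d < c → d ∈ ((J.erase c : Finset P) : Set P) := fun hd =>
    hmem (hJ hd.le hc.1) hd.ne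
  obtain ⟨χ, hχ⟩ := hF.exists_ringHom_closure c hcbot
    (R.restrict (isLowerSet_Iio c) fun d hd => hlt hd)
  obtain ⟨L', _, _, σ, y, hy⟩ := exists_isAlgClosed_algebraicIndependent L (F.gen c)
  let K := Subfield.closure (⋃ (d : P) (h : d < c), Set.range (F.map h.le))
  have hgen : AlgebraicIndependent K ((↑) : F.gen c → F.obj c) := by
    have h := hF c c le_rfl
    simp only [F.map_refl] at h
    refine h.subfield_mono (Subfield.closure_mono (Set.iUnion₂_subset fun d hd z hz => ?_))
    exact Set.mem_iUnion₂.2 ⟨d, hd.le, Set.mem_iUnion.2 ⟨hd.not_ge, hz⟩⟩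
  have hbasis : IsTranscendenceBasis K ((↑) : F.gen c → F.obj c) := by
    refine hgen.isTranscendenceBasis_iff_isAlgebraic.2
      ((IntermediateField.isAlgebraic_adjoin_iff_top).1 ⟨fun x => ?_⟩)
    have h := F.isAlgebraic c x
    have hle : Subfield.closure ((⋃ (e : P) (h : e < c), Set.range (F.map h.le)) ∪ F.gen c) ≤
        (IntermediateField.adjoin K (Set.range ((↑) : F.gen c → F.obj c))).toSubfield := by
      rw [← Subfield.closure_union_range_eq_adjoin, Subtype.range_coe]
      exact Subfield.closure_mono (Set.union_subset_union_left _ Subfield.subset_closure)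
    exact isAlgebraic_subfield_mono hle h
  let _ : Algebra K L' := (σ.comp χ).toAlgebra
  have hyK : AlgebraicIndependent K y :=
    AlgebraicIndependent.of_ringHom_of_comp_eq (σ.rangeRestrictField.comp χ) (RingHom.id L')
      (x := y) hy (RingHom.injective _) rfl
  obtain ⟨φ, hφ⟩ := hbasis.exists_algHom_of_isAlgClosed hyK
  have hφlt : ∀ (d : P) (h : d < c) (x : F.obj d),
      φ (F.map h.le x) = σ (R.hom ⟨d, hlt h⟩ x) := fun d h x =>
    (φ.commutes (⟨F.map h.le x, _⟩ : K)).trans (congrArg σ (hχ d h x))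
  -- When `d = c`, composing with `F.map h.le` replaces a cast between `F.obj d` and `F.obj c`.
  let hom : ∀ d : (J : Set P), F.obj d →+* L' := fun d =>
    if h : d.1 = c then (φ : F.obj c →+* L').comp (F.map h.le)
    else σ.comp (R.hom ⟨d, hmem d.2 h⟩)
  have hom_c : ∀ (d : (J : Set P)) (h : d.1 = c) (x : F.obj d), hom d x = φ (F.map h.le x) :=
    fun d h x => by simp only [hom, dif_pos h]; rfl
  have hom_ne : ∀ (d : (J : Set P)) (h : d.1 ≠ c) (x : F.obj d),
      hom d x = σ (R.hom ⟨d, hmem d.2 h⟩ x) := fun d h x => by simp only [hom, dif_neg h]; rfl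
  refine ⟨L', inferInstance, inferInstance, ⟨⟨hom, fun {d e} hde x => ?_, fun e => ?_⟩⟩⟩
  · by_cases he : e.1 = c
    · by_cases hd : d.1 = c
      · exact (hom_c e he _).trans ((congrArg φ (F.map_map _ _ x)).trans (hom_c d hd x).symm)
      · exact (hom_c e he _).trans ((congrArg φ (F.map_map _ _ x)).trans
          ((hφlt d (lt_of_le_of_ne (he ▸ hde) hd) x).trans (hom_ne d hd x).symm))
    · have hd : d.1 ≠ c := fun hd => he (le_antisymm (hc.2 e.2 (hd ▸ hde)) (hd ▸ hde))
      exact (hom_ne e he _).trans ((congrArg σ (R.hom_map (d := ⟨d, hmem d.2 hd⟩)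
        (e := ⟨e, hmem e.2 he⟩) hde x)).trans (hom_ne d hd x).symm)
  · by_cases he : e.1 = c
    · obtain ⟨e, heJ⟩ := e
      obtain rfl : e = c := he
      have h : (fun x : F.gen e => hom ⟨e, heJ⟩ x) = y := by
        funext x
        rw [hom_c _ rfl, F.map_refl]
        exact hφ x
      change AlgebraicIndependent _ fun x : F.gen e => hom ⟨e, heJ⟩ x
      rw [h]
      refine hy.subfield_mono (Subfield.closure_le.2 (Set.iUnion₂_subset fun d hd => ?_))
      rintro _ ⟨x, rfl⟩
      exact ⟨_, (hom_ne d (fun h => hd (show e ≤ d.1 from h.ge)) x).symm⟩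
    · let e' : ((J.erase c : Finset P) : Set P) := ⟨e, hmem e.2 he⟩
      have hx : AlgebraicIndependent ((R.span {d | ¬ e' ≤ d}).map σ)
          (fun x : F.gen e => hom e x) := by
        have h : (fun x : F.gen e => hom e x) = σ ∘ fun x : (F.restrict hJ').gen e' => R.hom e' x :=
          funext fun x => hom_ne e he x
        rw [h]
        exact (algebraicIndependent_subfield_map_iff σ _).2 (R.indep_span e')
      have hk : (R.span {d | ¬ e' ≤ d}).map σ ≤ σ.fieldRange := by
        rintro _ ⟨z, -, rfl⟩
        exact ⟨z, rfl⟩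
      -- The new field `F_c` may now lie in the base. When `e ≰ c`, it is algebraic over `y` and the
      -- old fields at indices not above `e`, and `y` is independent over all of `σ(L)`, so exchange
      -- applies.
      refine hx.exchange hk (fun x => ⟨_, (hom_ne e he x.1).symm⟩) hy ?_
      set Q := Subfield.closure (((R.span {d | ¬ e' ≤ d}).map σ : Set L') ∪ Set.range y)
      suffices h : Subfield.closure (⋃ (d : (J : Set P)) (_ : ¬ e ≤ d), Set.range (hom d)) ≤
          (algebraicClosure Q L').toSubfield from
        fun z hz => mem_algebraicClosure_iff.1 (h hz)
      have hmemQ : ∀ (d : P) (hd : d ∈ J) (hdc : d ≠ c) (_ : ¬ e.1 ≤ d) (x : F.obj d),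
          σ (R.hom ⟨d, hmem hd hdc⟩ x) ∈ Q := fun d hd hdc hed x =>
        Subfield.subset_closure (Or.inl ⟨_, R.hom_mem_span (d := ⟨d, hmem hd hdc⟩) hed x, rfl⟩)
      refine Subfield.closure_le.2 (Set.iUnion₂_subset fun d hd => ?_)
      rintro _ ⟨x, rfl⟩
      refine mem_algebraicClosure_iff.2 ?_
      by_cases hdc : d.1 = c
      · rw [hom_c d hdc]
        refine isAlgebraic_subfield_mono ?_
          ((F.isAlgebraic c (F.map hdc.le x)).subfield_map (φ : F.obj c →+* L'))
        rw [Subfield.map_le_iff_le_comap, Subfield.closure_le]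
        refine Set.union_subset (Set.iUnion₂_subset fun d' hd' => ?_) fun g hg => ?_
        · rintro _ ⟨w, rfl⟩
          change φ (F.map hd'.le w) ∈ Q
          rw [hφlt d' hd' w]
          exact hmemQ d' (hJ hd'.le hc.1) hd'.ne
            (fun h => hd (show e.1 ≤ d.1 from hdc ▸ h.trans hd'.le)) w
        · exact Subfield.subset_closure (Or.inr ⟨⟨g, hg⟩, (hφ ⟨g, hg⟩).symm⟩)
      · rw [hom_ne d hdc]
        exact isAlgebraic_algebraMap (⟨_, hmemQ d d.2 hdc hd x⟩ : Q)

/-- Every independent system has a realization in an algebraically closed field. -/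
theorem IsIndependent.exists_realization (hF : F.IsIndependent) :
    ∃ (L : Type u) (_ : Field L) (_ : IsAlgClosed L),
      Nonempty (F.Realization L) := by
  classical
  have main : ∀ (J : Finset P) (hJ : IsLowerSet (J : Set P)), ⊥ ∈ J →
      ∃ (L : Type u) (_ : Field L) (_ : IsAlgClosed L),
        Nonempty ((F.restrict hJ).Realization L) := by
    intro J
    induction J using Finset.strongInduction with
    | H J ih =>
    intro hJ hbot
    obtain ⟨c, hc⟩ := J.exists_maximal ⟨_, hbot⟩
    by_cases hcbot : c = ⊥
    · refine ⟨F.obj ⊥, inferInstance, inferInstance, ⟨hF.realization hJ ⊥ fun d hd => ?_⟩⟩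
      exact hcbot ▸ hc.2 hd (hcbot ▸ bot_le)
    · have hlow : IsLowerSet ((J.erase c : Finset P) : Set P) := by
        intro d e hed hd
        refine Finset.mem_coe.2 (Finset.mem_erase.2 ⟨?_, hJ hed (Finset.mem_of_mem_erase hd)⟩)
        rintro rfl
        exact Finset.ne_of_mem_erase hd
          (le_antisymm (hc.2 (Finset.mem_of_mem_erase hd) hed) hed)
      obtain ⟨L, _, _, ⟨R⟩⟩ := ih _ (Finset.erase_ssubset hc.1) hlow
        (Finset.mem_erase.2 ⟨Ne.symm hcbot, hbot⟩)
      exact hF.exists_realization_of_erase hJ hc hcbot hlow R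
  have _ : Fintype P := Fintype.ofFinite P
  obtain ⟨L, hL, hL', ⟨R⟩⟩ := main Finset.univ (fun _ _ _ _ => by simp) (Finset.mem_univ _)
  refine ⟨L, hL, hL', ⟨⟨fun d => R.hom ⟨d, by simp⟩,
    fun {d e} h x => R.hom_map (d := ⟨d, by simp⟩) (e := ⟨e, by simp⟩) h x,
    fun c => (R.indep ⟨c, by simp⟩).subfield_mono (Subfield.closure_mono fun z hz => ?_)⟩⟩⟩
  obtain ⟨d, hcd, hz⟩ := Set.mem_iUnion₂.1 hz
  exact Set.mem_iUnion₂.2 ⟨⟨d, by simp⟩, hcd, hz⟩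

end FieldSystem

/-! ### Between functors and systems of fields -/

theorem algebraicIndependent_of_forall_fin {k M ι : Type*} [Field k] [Field M] [Algebra k M]
    {x : ι → M} (h : ∀ (m : ℕ) (z : Fin m → ι), Function.Injective z →
      AlgebraicIndependent k (x ∘ z)) : AlgebraicIndependent k x := by
  rw [algebraicIndependent_iff]
  intro p hp
  obtain ⟨m, z, hz, q, rfl⟩ := MvPolynomial.exists_fin_rename p
  rw [MvPolynomial.aeval_rename] at hp
  rw [algebraicIndependent_iff.1 (h m z hz) q hp, map_zero]

namespace FieldSystem

/-- The system of fields given by a functor, with chosen relative transcendence bases. -/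
noncomputable def ofFunctor {P : Type} [Preorder P] (F : P ⥤ ACFModel.{u}) : FieldSystem.{u} P where
  obj d := F.obj d
  map h := F.map (homOfLE h)
  map_map h h' x := by
    have := F.map_comp (homOfLE h) (homOfLE h')
    exact (congrArg (fun f : F.obj _ →+* F.obj _ => f x) this).symm
  map_refl d x := congrArg (fun f : F.obj d →+* F.obj d => f x) (F.map_id d)
  gen d := (exists_isTranscendenceBasis (Subfield.closure
    (⋃ (e : P) (h : e < d), Set.range (F.map (homOfLE h.le) : F.obj e →+* F.obj d)))
    (F.obj d)).choose
  isAlgebraic d x := by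
    have hs := (exists_isTranscendenceBasis (Subfield.closure
      (⋃ (e : P) (h : e < d), Set.range (F.map (homOfLE h.le) : F.obj e →+* F.obj d)))
      (F.obj d)).choose_spec
    have h := hs.isAlgebraic_field.isAlgebraic x
    refine isAlgebraic_subfield_mono ?_ (k₁ := (IntermediateField.adjoin _ _).toSubfield) h
    rw [← Subfield.closure_union_range_eq_adjoin, Subtype.range_coe, Subfield.closure_le,
      Set.union_subset_iff, SetLike.coe_subset_coe]
    exact ⟨Subfield.closure_mono Set.subset_union_left,
      Set.subset_union_right.trans Subfield.subset_closure⟩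

theorem algebraicIndependent_gen_ofFunctor {P : Type} [Preorder P] (F : P ⥤ ACFModel.{u}) (d : P) :
    AlgebraicIndependent (Subfield.closure
      (⋃ (e : P) (h : e < d), Set.range ((ofFunctor F).map h.le)))
      ((↑) : (ofFunctor F).gen d → (ofFunctor F).obj d) :=
  (exists_isTranscendenceBasis (Subfield.closure
    (⋃ (e : P) (h : e < d), Set.range (F.map (homOfLE h.le) : F.obj e →+* F.obj d)))
    (F.obj d)).choose_spec.1

/-- Finite tuples of generators of `F_c` are independent over the predecessors of `c`, and remain so
in `F_a`; the independence hypothesis then applies to them. -/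
theorem isIndependent_ofFunctor {P : Type} [Preorder P] {F : P ⥤ ACFModel.{u}}
    (hF : IsIndependentSystem ACFModel.Indep F) : (ofFunctor F).IsIndependent := by
  intro a c hca
  refine algebraicIndependent_of_forall_fin fun m z hz => ?_
  have h₁ := (algebraicIndependent_subfield_map_iff ((ofFunctor F).map hca) _).2
    ((algebraicIndependent_gen_ofFunctor F c).comp z hz)
  have h₂ := hF a c hca m (fun i => (ofFunctor F).map hca (z i)) (fun i => ⟨_, rfl⟩) ?_
  · refine h₂.subfield_mono (Subfield.closure_mono ?_)
    exact Set.subset_union_right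
  · refine h₁.subfield_mono (Subfield.closure_le.2 (Set.iUnion₂_subset fun d hd => ?_))
    rintro _ ⟨x, rfl⟩
    exact ⟨(ofFunctor F).map hd.le x,
      Subfield.subset_closure (Set.mem_iUnion₂.2 ⟨d, hd, x, rfl⟩), (ofFunctor F).map_map _ _ x⟩

end FieldSystem

/-- The functor of inclusions between members of a monotone family of algebraically closed
subfields. -/
def ACFModel.ofSubfields {P : Type} [Preorder P] {L : Type u} [Field L] (S : P → Subfield L)
    (hS : Monotone S) (hcl : ∀ a, IsAlgClosed (S a)) : P ⥤ ACFModel.{u} where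
  obj a := ⟨S a⟩
  map f := Subfield.inclusion (hS (leOfHom f))
  map_id _ := rfl
  map_comp _ _ := rfl

/-- Independence can be tested in the ambient `L`, over all `d` with `b ≰ d` at once; these include
every `c < b`, so the base `C ∪ B` is covered. -/
theorem ACFModel.isIndependentSystem_ofSubfields {P : Type} [Preorder P] {L : Type u} [Field L]
    {S : P → Subfield L} {hS : Monotone S} {hcl : ∀ a, IsAlgClosed (S a)}
    (h : ∀ (b : P) (m : ℕ) (x : Fin m → L), (∀ i, x i ∈ S b) →
      AlgebraicIndependent (Subfield.closure (⋃ (c : P) (_ : c < b), (S c : Set L))) x →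
      AlgebraicIndependent (Subfield.closure (⋃ (d : P) (_ : ¬ b ≤ d), (S d : Set L))) x) :
    IsIndependentSystem ACFModel.Indep (ACFModel.ofSubfields S hS hcl) := by
  intro a b hba m x hx hind
  have hind' := (algebraicIndependent_subfield_map_iff (S a).subtype _).2 hind
  have h₁ := h b m ((S a).subtype ∘ x) (fun i => ?_) (hind'.subfield_mono ?_)
  · refine (algebraicIndependent_subfield_map_iff (S a).subtype _).1 (h₁.subfield_mono ?_)
    refine Subfield.map_le_iff_le_comap.2 (Subfield.closure_le.2 ?_)
    refine Set.union_subset (Set.iUnion₂_subset fun c hc => ?_)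
      (Set.iUnion₂_subset fun d hd => Set.iUnion_subset fun hbd => ?_)
    · rintro _ ⟨y, rfl⟩
      exact Subfield.subset_closure (Set.mem_iUnion₂.2 ⟨c, hc.not_ge, y.2⟩)
    · rintro _ ⟨y, rfl⟩
      exact Subfield.subset_closure (Set.mem_iUnion₂.2 ⟨d, hbd, y.2⟩)
  · obtain ⟨y, hy⟩ := hx i
    have h : ((S a).subtype ∘ x) i = (S b).subtype y := congrArg (S a).subtype hy.symm
    exact h ▸ Subtype.prop (p := (· ∈ S b)) y
  · refine Subfield.closure_le.2 (Set.iUnion₂_subset fun c hc z hz => ?_)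
    exact ⟨⟨z, hS (hc.le.trans hba) hz⟩, Subfield.subset_closure
      (Set.mem_iUnion₂.2 ⟨c, hc, ⟨z, hz⟩, rfl⟩), rfl⟩

namespace FieldSystem.Realization

variable {n : ℕ} {F : FieldSystem.{u} (ProperSubsets n)} {L : Type u} [Field L]

/-- The family of the images of a realization, with the whole field on top. -/
noncomputable def subfields (R : F.Realization L) (a : Finset (Fin n)) : Subfield L :=
  if h : a ≠ Finset.univ then (R.hom ⟨a, h⟩).fieldRange else ⊤

theorem subfields_coe (R : F.Realization L) (a : ProperSubsets n) :
    R.subfields a = (R.hom a).fieldRange :=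
  dif_pos a.2

theorem subfields_univ (R : F.Realization L) : R.subfields Finset.univ = ⊤ :=
  dif_neg fun h => h rfl

theorem subfields_mono (R : F.Realization L) : Monotone R.subfields := by
  intro a b hab
  by_cases hb : b = Finset.univ
  · rw [hb, subfields_univ]
    exact le_top
  · have ha : a ≠ Finset.univ := fun h => hb (Finset.univ_subset_iff.1 (h ▸ hab))
    rw [R.subfields_coe ⟨a, ha⟩, R.subfields_coe ⟨b, hb⟩]
    rintro _ ⟨x, rfl⟩
    exact ⟨F.map (d := ⟨a, ha⟩) (e := ⟨b, hb⟩) hab x, R.hom_map _ x⟩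

theorem isAlgClosed_subfields [IsAlgClosed L] (R : F.Realization L) (a : Finset (Fin n)) :
    IsAlgClosed (R.subfields a) := by
  by_cases ha : a = Finset.univ
  · rw [ha, subfields_univ]
    exact IsAlgClosed.of_ringEquiv L _ Subfield.topEquiv.symm
  · rw [R.subfields_coe ⟨a, ha⟩]
    exact IsAlgClosed.of_ringEquiv _ _ (R.hom ⟨a, ha⟩).rangeRestrictFieldEquiv

/-- For proper `b`, independence passes from the chosen generators to arbitrary tuples by
`AlgebraicIndependent.of_isAlgebraic_closure`. For the top set, the `d` with `b ≰ d` are exactly the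
proper subsets, so nothing changes. -/
theorem algebraicIndependent_of_mem_subfields (R : F.Realization L) (b : Finset (Fin n)) (m : ℕ)
    (x : Fin m → L) (hx : ∀ i, x i ∈ R.subfields b)
    (hind : AlgebraicIndependent (Subfield.closure
      (⋃ (c : Finset (Fin n)) (_ : c < b), (R.subfields c : Set L))) x) :
    AlgebraicIndependent (Subfield.closure
      (⋃ (d : Finset (Fin n)) (_ : ¬ b ≤ d), (R.subfields d : Set L))) x := by
  by_cases hb : b = Finset.univ
  · subst hb
    refine hind.subfield_mono (Subfield.closure_mono (Set.iUnion₂_subset fun d hd z hz => ?_))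
    exact Set.mem_iUnion₂.2 ⟨d, lt_of_le_not_ge (Finset.subset_univ d) hd, hz⟩
  let b' : ProperSubsets n := ⟨b, hb⟩
  have hproper : ∀ d : Finset (Fin n), ¬ b ≤ d → d ≠ Finset.univ := by
    rintro _ h rfl
    exact h (Finset.subset_univ b)
  have hE : Subfield.closure (⋃ (d : Finset (Fin n)) (_ : ¬ b ≤ d), (R.subfields d : Set L)) ≤
      R.span {d | ¬ b' ≤ d} := by
    refine Subfield.closure_le.2 (Set.iUnion₂_subset fun d hd => ?_)
    rw [R.subfields_coe ⟨d, hproper d hd⟩]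
    rintro _ ⟨y, rfl⟩
    exact R.hom_mem_span (d := ⟨d, hproper d hd⟩) hd y
  refine AlgebraicIndependent.subfield_mono hE ?_
  refine AlgebraicIndependent.of_isAlgebraic_closure (F := R.subfields b) (le_trans ?_ hE) ?_
    (R.indep_span b') ?_ hind hx
  · exact Subfield.closure_mono (Set.iUnion₂_subset fun c hc z hz =>
      Set.mem_iUnion₂.2 ⟨c, hc.not_ge, hz⟩)
  · exact Subfield.closure_le.2 (Set.iUnion₂_subset fun c hc => R.subfields_mono hc.le)
  · intro z hz
    rw [R.subfields_coe b'] at hz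
    obtain ⟨y, rfl⟩ := hz
    refine isAlgebraic_subfield_mono ?_ ((F.isAlgebraic b' y).subfield_map (R.hom b'))
    rw [Subfield.map_le_iff_le_comap, Subfield.closure_le]
    refine Set.union_subset (Set.iUnion₂_subset fun c hc => ?_) fun g hg => ?_
    · rintro _ ⟨w, rfl⟩
      refine Subfield.subset_closure (Or.inl (Subfield.subset_closure
        (Set.mem_iUnion₂.2 ⟨c, hc, ?_⟩)))
      rw [R.subfields_coe c, R.hom_map]
      exact ⟨w, rfl⟩
    · exact Subfield.subset_closure (Or.inr ⟨⟨g, hg⟩, rfl⟩)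

end FieldSystem.Realization

/-! ### Amalgamation -/

/-- Treated apart since there are no proper subsets, hence no bottom index; any algebraically closed
field serves as the single vertex. -/
theorem hasAmalgamation_zero : HasAmalgamation (K := ACFModel.{u}) ACFModel.Indep 0 := by
  intro F _
  have hempty : IsEmpty (ProperSubsets 0) := ⟨fun a => a.2 (Subsingleton.elim _ _)⟩
  let S : Finset (Fin 0) → Subfield (AlgebraicClosure (ULift.{u} ℚ)) := fun _ => ⊤
  have hS : Monotone S := fun _ _ _ => le_rfl
  have hcl : ∀ a, IsAlgClosed (S a) := fun _ =>
    IsAlgClosed.of_ringEquiv (AlgebraicClosure (ULift.{u} ℚ)) _ Subfield.topEquiv.symm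
  refine ⟨ACFModel.ofSubfields S hS hcl, ACFModel.isIndependentSystem_ofSubfields ?_,
    ⟨NatIso.ofComponents (fun a => hempty.elim a) fun {a} => hempty.elim a⟩⟩
  intro b m x _ h
  refine h.subfield_mono (Subfield.closure_mono (Set.iUnion₂_subset fun d hd => ?_))
  exact absurd (Subsingleton.elim b d).le hd

theorem hasAmalgamation_succ (n : ℕ) :
    HasAmalgamation (K := ACFModel.{u}) ACFModel.Indep (n + 1) := by
  intro F hF
  let _ : SemilatticeInf (ProperSubsets (n + 1)) := Subtype.semilatticeInf fun a b ha _ h =>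
    ha (Finset.univ_subset_iff.1 (h ▸ Finset.inter_subset_left))
  let _ : OrderBot (ProperSubsets (n + 1)) :=
    Subtype.orderBot (Finset.univ_nonempty (α := Fin (n + 1))).ne_empty.symm
  obtain ⟨L, _, _, ⟨R⟩⟩ := (FieldSystem.isIndependent_ofFunctor hF).exists_realization
  refine ⟨ACFModel.ofSubfields R.subfields R.subfields_mono R.isAlgClosed_subfields,
    ACFModel.isIndependentSystem_ofSubfields R.algebraicIndependent_of_mem_subfields,
    ⟨(NatIso.ofComponents (fun a => ?_) ?_).symm⟩⟩
  · let e : F.obj a ≃+* R.subfields a :=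
      (R.hom a).rangeRestrictFieldEquiv.trans (RingEquiv.subfieldCongr (R.subfields_coe a).symm)
    exact
      { hom := (e : F.obj a →+* R.subfields a)
        inv := (e.symm : R.subfields a →+* F.obj a)
        hom_inv_id := RingHom.ext e.symm_apply_apply
        inv_hom_id := RingHom.ext e.apply_symm_apply }
  · intro a b f
    exact RingHom.ext fun x => Subtype.ext (R.hom_map (leOfHom f) x)

theorem mainTheorem8 (n : ℕ) :
    HasAmalgamation (K := ACFModel.{u}) ACFModel.Indep n := by
  cases n with
  | zero => exact hasAmalgamation_zero
  | succ n => exact hasAmalgamation_succ n
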